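/- A \emph{metrized graph} $\Gamma$ is a finite, non-empty, connected graph, self-loops and multiple edges allowed, with vertex set $V$ and edge set $E$, in which every edge $e$ is identified with a segment of length $L_e>0$ (with its end points glued to vertices). Write $\ell(\Gamma)=\sum_{e\in E}L_e$, let $v(p)$ be the number of directions emanating from $p\in\Gamma$, and for $x,y\in\Gamma$ let $r(x,y)$ be the effective resistance between $x$ and $y$ when $\Gamma$ is viewed as an electric circuit in which each edge has resistance equal to its length. For $e\in E$, let $R_e\in[0,\infty]$ be the effective resistance between the end points of $e$ in the graph obtained from $\Gamma$ by deleting the interior of $e$ ($R_e=\infty$ if this disconnects the end points, in which case $\frac{1}{L_e+R_e}=0$). Let $q:V\to\mathbb{Z}_{\ge 0}$ be such that the canonical divisor $K=\sum_{p\in V}(v(p)-2+2q(p))\,p$ is effective; the pair $(\Gamma,q)$ is then called a \emph{polarized metrized graph} (pm-graph). Its genus is $\bar g=|E|-|V|+1+\sum_{p\in V}q(p)$. Put $$\delta_K=\sum_{p\in V}(v(p)-2+2q(p))\,\delta_p,\qquad \mu_{ad}=\frac1{\bar g}\Big(\sum_{p\in V}q(p)\,\delta_p+\sum_{e\in E}\frac{dx|_e}{L_e+R_e}\Big),$$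 where $\delta_p$ is the Dirac measure at $p$ and $dx|_e$ is Lebesgue measure on $e$, and define $$\epsilon(\Gamma)=\iint_{\Gamma\times\Gamma}r(x,y)\,\delta_K(x)\,\mu_{ad}(y),\qquad Z(\Gamma)=\frac12\iint_{\Gamma\times\Gamma}r(x,y)\,\mu_{ad}(x)\,\mu_{ad}(y),$$ $$\varphi(\Gamma)=3\bar g\,Z(\Gamma)-\frac14\big(\epsilon(\Gamma)+\ell(\Gamma)\big),\qquad \lambda(\Gamma)=\frac{\bar g-1}{6(2\bar g+1)}\,\varphi(\Gamma)+\frac1{12}\big(\epsilon(\Gamma)+\ell(\Gamma)\big).$$ \textbf{Proposition.} Let $(\Gamma,q)$ be a pm-graph with exactly one vertex and with $|E|\ge 1$ edges, all of them self-loops at that vertex. Then $$\varphi(\Gamma)=\frac{\bar g-1}{6\bar g}\,\ell(\Gamma),\qquad Z(\Gamma)=\frac{2\bar g-1}{12\bar g^{2}}\,\ell(\Gamma),\qquad \lambda(\Gamma)=\frac{\bar g}{8\bar g+4}\,\ell(\Gamma),\qquad \epsilon(\Gamma)=\frac{\bar g-1}{3\bar g}\,\ell(\Gamma).$$ -/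

import Mathlib

/-- A finite multigraph (self-loops and multiple edges allowed), not necessarily connected, in which
every edge `e` is parametrized by the segment `[0, length e]`, starting at the vertex `src e` and
ending at the vertex `tgt e`. -/
structure LengthGraph (V E : Type*) where
  src : E → V
  tgt : E → V
  length : E → ℝ
  length_pos : ∀ e, 0 < length e

namespace LengthGraph

variable {V E : Type*}

/-- The points of the geometric realization: the vertices, and the interior points of the edges. -/
inductive Point (G : LengthGraph V E) where
  | vertex (v : V) : Point G
  | interior (e : E) (t : ℝ) (ht : t ∈ Set.Ioo 0 (G.length e)) : Point G

open Classical in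
/-- The parametrization of the edge `e` by `[0, length e]`, extended to `ℝ` by constants. -/
noncomputable def edgePath (G : LengthGraph V E) (e : E) (t : ℝ) : G.Point :=
  if ht : t ∈ Set.Ioo 0 (G.length e) then Point.interior e t ht
  else if t ≤ 0 then Point.vertex (G.src e) else Point.vertex (G.tgt e)

/-- An edge together with one of its two directions of travel; `true` is the given direction. -/
noncomputable def path (G : LengthGraph V E) (d : E × Bool) (t : ℝ) : G.Point :=
  if d.2 then G.edgePath d.1 t else G.edgePath d.1 (G.length d.1 - t)

/-- The directions emanating from the point `z`. -/
def directions (G : LengthGraph V E) (z : G.Point) : Set ((E × Bool) × ℝ) :=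
  {d | d.2 ∈ Set.Ico 0 (G.length d.1.1) ∧ G.path d.1 d.2 = z}

/-- The number of directions emanating from `z`. A self-loop at a vertex contributes two. -/
noncomputable def valence (G : LengthGraph V E) (z : G.Point) : ℕ :=
  (G.directions z).ncard

open Classical in
/-- `f` is a voltage function on `G`, viewed as an electric circuit whose edges have resistance
equal to their length, when unit current enters at `y` and exits at `x`: `f` is continuous and
piecewise affine (that is, affine near every point in each direction emanating from it, with
slope `σ`), the current in a direction is minus the slope (Ohm), and the total current that leaves
a point `z` through the edges is the current fed in at `z` (Kirchhoff). -/
def IsVoltage (G : LengthGraph V E) (x y : G.Point) (f : G.Point → ℝ) : Prop :=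
  ∃ σ : E × Bool → ℝ → ℝ,
    (∀ d : E × Bool, ∀ t ∈ Set.Ico 0 (G.length d.1),
      ∀ᶠ s in nhdsWithin t (Set.Ioi t), f (G.path d s) = f (G.path d t) + σ d t * (s - t)) ∧
    ∀ z : G.Point, -(∑ᶠ d ∈ G.directions z, σ d.1 d.2) =
      (if z = y then 1 else 0) - (if z = x then 1 else 0)

/-- The effective resistance between `x` and `y`: the voltage drop `f y - f x` when unit current
enters at `y` and exits at `x`. This number is the same for all such voltage functions `f`. If `x`
and `y` lie in different components, there is no such `f`, and the resistance is `∞`. -/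
noncomputable def resistance (G : LengthGraph V E) (x y : G.Point) : ENNReal :=
  ⨅ (f : G.Point → ℝ) (_ : G.IsVoltage x y f), ENNReal.ofReal (f y - f x)

/-- The graph with the interior of the edge `e` deleted. -/
def deleteEdge (G : LengthGraph V E) (e : E) : LengthGraph V {e' : E // e' ≠ e} where
  src e' := G.src e'
  tgt e' := G.tgt e'
  length e' := G.length e'
  length_pos e' := G.length_pos e'

/-- The resistance between the end points of `e` after the interior of `e` is deleted
(`∞` if `e` is a bridge). -/
noncomputable def deletedResistance (G : LengthGraph V E) (e : E) : ENNReal :=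
  (G.deleteEdge e).resistance (Point.vertex (G.src e)) (Point.vertex (G.tgt e))

/-- The quotient topology: the segments `[0, length e]` glued at their end points. -/
noncomputable instance (G : LengthGraph V E) : TopologicalSpace G.Point :=
  ⨆ e : E, TopologicalSpace.coinduced (G.edgePath e) inferInstance

noncomputable instance (G : LengthGraph V E) : MeasurableSpace G.Point := borel G.Point

instance (G : LengthGraph V E) : BorelSpace G.Point := ⟨rfl⟩

theorem continuous_edgePath (G : LengthGraph V E) (e : E) : Continuous (G.edgePath e) :=
  continuous_iSup_rng (i := e) continuous_coinduced_rng

/-- The Lebesgue measure `dx` on the edge `e`, as a measure on the graph. -/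
noncomputable def edgeMeasure (G : LengthGraph V E) (e : E) : MeasureTheory.Measure G.Point :=
  (MeasureTheory.volume.restrict (Set.Icc 0 (G.length e))).map (G.edgePath e)

/-- The sum of the lengths of the edges. -/
noncomputable def totalLength [Fintype E] (G : LengthGraph V E) : ℝ :=
  ∑ e, G.length e

/-- The first Betti number `e - v + 1` (of a connected graph). -/
def bettiNumber [Fintype V] [Fintype E] (_ : LengthGraph V E) : ℤ :=
  (Fintype.card E : ℤ) - Fintype.card V + 1

end LengthGraph

/-- A metrized graph (with finite vertex and edge sets): non-empty and connected. -/
structure MetrizedGraph (V E : Type*) [Fintype V] [Fintype E] extends LengthGraph V E where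
  nonempty : Nonempty V
  connected : ∀ u v : V, Relation.EqvGen (fun a b => ∃ e, src e = a ∧ tgt e = b) u v

/-- A polarized metrized graph: a metrized graph with a function `q ≥ 0` on the vertices for which
the canonical divisor `∑ (valence p - 2 + 2 q p) p` is effective. -/
structure PMGraph (V E : Type*) [Fintype V] [Fintype E] extends MetrizedGraph V E where
  q : V → ℕ
  effective : ∀ p : V,
    0 ≤ (toLengthGraph.valence (LengthGraph.Point.vertex p) : ℤ) - 2 + 2 * (q p : ℤ)

namespace PMGraph

variable {V E : Type*} [Fintype V] [Fintype E]

/-- The coefficient of the canonical divisor `K` at `p`. -/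
noncomputable def canonicalDivisor (G : PMGraph V E) (p : V) : ℤ :=
  (G.valence (LengthGraph.Point.vertex p) : ℤ) - 2 + 2 * (G.q p : ℤ)

/-- The measure `δ_K`. The coefficients of `K` are non-negative, so `toNat` loses nothing. -/
noncomputable def canonicalDivisorMeasure (G : PMGraph V E) : MeasureTheory.Measure G.Point :=
  ∑ p : V, (G.canonicalDivisor p).toNat •
    MeasureTheory.Measure.dirac (LengthGraph.Point.vertex p : G.Point)

/-- The genus of the polarized metrized graph. -/
def genus (G : PMGraph V E) : ℤ :=
  G.bettiNumber + ∑ p : V, (G.q p : ℤ)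

/-- The admissible measure `(1 / genus) (∑_p q(p) δ_p + ∑_e dx / (L_e + R_e))`. -/
noncomputable def admissibleMeasure (G : PMGraph V E) : MeasureTheory.Measure G.Point :=
  ENNReal.ofReal (1 / (G.genus : ℝ)) •
    (∑ p : V, G.q p • MeasureTheory.Measure.dirac (LengthGraph.Point.vertex p : G.Point) +
      ∑ e : E, (ENNReal.ofReal (G.length e) + G.deletedResistance e)⁻¹ • G.edgeMeasure e)

/-- The resistance function (finite on a connected graph) as a real-valued function. -/
noncomputable def r (G : PMGraph V E) (x y : G.Point) : ℝ :=
  (G.resistance x y).toReal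

/-- The invariant `ε`. -/
noncomputable def epsilonInv (G : PMGraph V E) : ℝ :=
  ∫ z : G.Point × G.Point, G.r z.1 z.2 ∂(G.canonicalDivisorMeasure.prod G.admissibleMeasure)

/-- The invariant `Z`. -/
noncomputable def zInv (G : PMGraph V E) : ℝ :=
  (1 / 2) * ∫ z : G.Point × G.Point, G.r z.1 z.2 ∂(G.admissibleMeasure.prod G.admissibleMeasure)

/-- The invariant `φ`. -/
noncomputable def phiInv (G : PMGraph V E) : ℝ :=
  3 * (G.genus : ℝ) * G.zInv - (1 / 4) * (G.epsilonInv + G.totalLength)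

/-- The invariant `λ`. -/
noncomputable def lambdaInv (G : PMGraph V E) : ℝ :=
  ((G.genus : ℝ) - 1) / (6 * (2 * (G.genus : ℝ) + 1)) * G.phiInv +
    (1 / 12) * (G.epsilonInv + G.totalLength)

end PMGraph

/-!
A metrized graph with one vertex `p` is a bouquet of circles, so its resistance function is the sum
of those of the circles: `r(x, y) = ∑ₑ ρₑ(xₑ, yₑ)` with `ρₑ(s, t) = |s - t| - (s - t)² / Lₑ`, where
`xₑ` is the position of `x` on the circle `e`. Indeed, the sum over the circles of the voltages
grounded at `p` is a voltage on the bouquet, and two voltages differ by a constant, because a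
function without kinks on a circle is constant.

All the deleted resistances vanish, so `g μ_ad = q δ_p + ∑ₑ dx|ₑ / Lₑ` is mapped by `x ↦ xₑ` to
`(g - 1) δ₀ + dx / Lₑ`. The average of `ρₑ(s, ·)` over the circle is `Lₑ / 6` for every `s`, whence
`g ∫ r(x, y) μ_ad(y) = (g - 1) r(x, p) + ℓ / 6`. Integrating this against `δ_K = (2 g - 2) δ_p`
gives `ε`, and integrating it against `μ_ad` gives `Z`.
-/

open Set Filter MeasureTheory
open scoped Topology

/-! ### The circle -/

/-- The effective resistance between the points at positions `s` and `t` of a circle of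
circumference `L`: two resistors `|s - t|` and `L - |s - t|` in parallel. -/
noncomputable def circleResistance (L s t : ℝ) : ℝ :=
  |s - t| - (s - t) ^ 2 / L

section CircleResistance

variable {L s t : ℝ}

theorem circleResistance_comm (L s t : ℝ) : circleResistance L s t = circleResistance L t s := by
  rw [circleResistance, circleResistance, abs_sub_comm, sub_sq_comm]

theorem circleResistance_nonneg (hL : 0 < L) (hs : s ∈ Icc 0 L) (ht : t ∈ Icc 0 L) :
    0 ≤ circleResistance L s t := by
  have hst : |s - t| ≤ L := abs_sub_le_of_nonneg_of_le hs.1 hs.2 ht.1 ht.2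
  rw [circleResistance, sub_nonneg, div_le_iff₀ hL, ← sq_abs, sq]
  exact mul_le_mul_of_nonneg_left hst (abs_nonneg _)

theorem circleResistance_le (hs : s ∈ Icc 0 L) (ht : t ∈ Icc 0 L) : circleResistance L s t ≤ L := by
  have hst : |s - t| ≤ L := abs_sub_le_of_nonneg_of_le hs.1 hs.2 ht.1 ht.2
  have hsq : 0 ≤ (s - t) ^ 2 / L := div_nonneg (sq_nonneg _) (hs.1.trans hs.2)
  rw [circleResistance]
  linarith

theorem continuous_circleResistance (L : ℝ) :
    Continuous fun p : ℝ × ℝ => circleResistance L p.1 p.2 := by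
  unfold circleResistance
  fun_prop

theorem integral_abs_sub_of_mem_Icc {a b : ℝ} (hs : s ∈ Icc a b) :
    ∫ t in a..b, |s - t| = ((s - a) ^ 2 + (b - s) ^ 2) / 2 := by
  have hleft : ∫ t in a..s, |s - t| = ∫ t in a..s, (s - t) := by
    refine intervalIntegral.integral_congr fun t ht => ?_
    rw [uIcc_of_le hs.1] at ht
    exact abs_of_nonneg (sub_nonneg.2 ht.2)
  have hright : ∫ t in s..b, |s - t| = ∫ t in s..b, (t - s) := by
    refine intervalIntegral.integral_congr fun t ht => ?_
    rw [uIcc_of_le hs.2] at ht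
    exact (abs_sub_comm s t).trans (abs_of_nonneg (sub_nonneg.2 ht.1))
  have hint : ∀ c d, IntervalIntegrable (fun t => |s - t|) volume c d :=
    (continuous_const.sub continuous_id).abs.intervalIntegrable
  rw [← intervalIntegral.integral_add_adjacent_intervals (hint a s) (hint s b), hleft, hright,
    intervalIntegral.integral_sub (by simp) (by simp),
    intervalIntegral.integral_sub (by simp) (by simp)]
  simp only [intervalIntegral.integral_const, integral_id, smul_eq_mul]
  ring

theorem integral_circleResistance (hs : s ∈ Icc 0 L) :
    ∫ t in (0 : ℝ)..L, circleResistance L s t = L ^ 2 / 6 := by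
  rcases (hs.1.trans hs.2).eq_or_lt with rfl | hL
  · simp
  have hsq : ∫ t in (0 : ℝ)..L, (s - t) ^ 2 / L = (s ^ 3 + (L - s) ^ 3) / (3 * L) := by
    rw [intervalIntegral.integral_div,
      intervalIntegral.integral_comp_sub_left (fun t => t ^ 2) s, integral_pow]
    field_simp
    norm_num
    ring
  simp only [circleResistance]
  rw [intervalIntegral.integral_sub (Continuous.intervalIntegrable (by fun_prop) _ _)
    (Continuous.intervalIntegrable (by fun_prop) _ _), hsq, integral_abs_sub_of_mem_Icc hs]
  field_simp
  ring

end CircleResistance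

/-! ### Piecewise affine functions -/

/-- `g` is affine with slope `c` on an interval `[t, t + δ)`, `δ > 0`. The slope to the left of `t`
is handled by reflecting `g`. -/
def HasRightSlope (g : ℝ → ℝ) (c t : ℝ) : Prop :=
  ∀ᶠ s in 𝓝[>] t, g s = g t + c * (s - t)

namespace HasRightSlope

variable {f g : ℝ → ℝ} {c d t L : ℝ}

theorem add (hf : HasRightSlope f c t) (hg : HasRightSlope g d t) :
    HasRightSlope (fun s => f s + g s) (c + d) t := by
  filter_upwards [hf, hg] with s hfs hgs
  rw [hfs, hgs]
  ring

theorem sub (hf : HasRightSlope f c t) (hg : HasRightSlope g d t) :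
    HasRightSlope (fun s => f s - g s) (c - d) t := by
  filter_upwards [hf, hg] with s hfs hgs
  rw [hfs, hgs]
  ring

theorem const_mul (c t : ℝ) : HasRightSlope (fun s => c * s) c t :=
  Eventually.of_forall fun s => by ring

theorem max_sub_zero (a t : ℝ) :
    HasRightSlope (fun s => max (s - a) 0) (if a ≤ t then 1 else 0) t := by
  split_ifs with hat
  · filter_upwards [self_mem_nhdsWithin] with s (hts : t < s)
    rw [max_eq_left (by linarith), max_eq_left (by linarith)]
    ring
  · rw [not_le] at hat
    filter_upwards [nhdsWithin_le_nhds (Iio_mem_nhds hat)] with s (hsa : s < a)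
    rw [max_eq_right (by linarith), max_eq_right (by linarith)]
    ring

theorem congr_of_eqOn_Ico {b : ℝ} (hf : HasRightSlope f c t) (htb : t < b)
    (hgf : EqOn g f (Ico t b)) : HasRightSlope g c t := by
  filter_upwards [hf, Ioo_mem_nhdsGT htb] with s hfs hs
  rw [hgf (Ioo_subset_Ico_self hs), hgf ⟨le_rfl, htb⟩, hfs]

theorem continuousWithinAt (h : HasRightSlope g c t) : ContinuousWithinAt g (Ici t) t := by
  have haffine : ContinuousWithinAt (fun s => g t + c * (s - t)) (Ioi t) t :=
    Continuous.continuousWithinAt (by fun_prop)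
  exact continuousWithinAt_Ioi_iff_Ici.1 (haffine.congr_of_eventuallyEq h (by simp))

theorem continuousWithinAt_Iic (h : HasRightSlope (fun s => g (L - s)) c (L - t)) :
    ContinuousWithinAt g (Iic t) t := by
  have hreflect : ContinuousWithinAt (fun s => L - s) (Iic t) t :=
    (continuous_sub_left L).continuousWithinAt
  simpa [Function.comp_def] using
    h.continuousWithinAt.comp hreflect fun s hs => sub_le_sub_left hs L

theorem eventually_nhds (hright : HasRightSlope g c t)
    (hleft : HasRightSlope (fun s => g (L - s)) (-c) (L - t)) :
    ∀ᶠ s in 𝓝 t, g s = g t + c * (s - t) := by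
  have hreflect : Tendsto (fun s => L - s) (𝓝[<] t) (𝓝[>] (L - t)) :=
    tendsto_nhdsWithin_iff.2 ⟨((continuous_sub_left L).tendsto t).mono_left
      nhdsWithin_le_nhds, eventually_mem_nhdsWithin.mono fun s hs => sub_lt_sub_left hs L⟩
  rw [← nhdsLT_sup_nhdsGE, ← nhdsGT_sup_nhdsWithin_singleton, eventually_sup, eventually_sup]
  refine ⟨?_, hright, by simp⟩
  filter_upwards [hreflect.eventually hleft] with s hs
  rw [sub_sub_cancel, sub_sub_cancel] at hs
  rw [hs]
  ring

end HasRightSlope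

section LocallyAffine

variable {g σ : ℝ → ℝ} {a b c t u y : ℝ}

theorem hasDerivAt_of_eventually_eq_affine (h : ∀ᶠ s in 𝓝 u, g s = y + c * (s - t)) :
    HasDerivAt g c u := by
  have haffine : HasDerivAt (fun s => y + c * (s - t)) c u := by
    simpa using (((hasDerivAt_id u).sub_const t).const_mul c).const_add y
  exact haffine.congr_of_eventuallyEq h

theorem slope_eq_of_locally_affine (h : ∀ t ∈ Ioo a b, ∀ᶠ s in 𝓝 t, g s = g t + σ t * (s - t))
    (ht : t ∈ Ioo a b) (hu : u ∈ Ioo a b) : σ t = σ u := by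
  have hσ : ∀ t ∈ Ioo a b, HasDerivAt σ 0 t := by
    intro t ht
    have hloc : σ =ᶠ[𝓝 t] fun _ => σ t := by
      filter_upwards [(h t ht).eventually_nhds, isOpen_Ioo.mem_nhds ht] with s hs hsI
      exact (hasDerivAt_of_eventually_eq_affine (h s hsI)).unique
        (hasDerivAt_of_eventually_eq_affine hs)
    exact (hasDerivAt_const t (σ t)).congr_of_eventuallyEq hloc
  exact isOpen_Ioo.is_const_of_deriv_eq_zero isPreconnected_Ioo
    (fun s hs => (hσ s hs).differentiableAt.differentiableWithinAt) (fun s hs => (hσ s hs).deriv)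
    ht hu

theorem eq_left_of_locally_affine (hcont : ContinuousOn g (Icc a b)) (hends : g a = g b)
    (h : ∀ t ∈ Ioo a b, ∀ᶠ s in 𝓝 t, g s = g t + σ t * (s - t)) (ht : t ∈ Icc a b) :
    g t = g a := by
  rcases ht.1.eq_or_lt with rfl | hat
  · rfl
  have hderiv : ∀ s ∈ Ioo a b, HasDerivAt g (σ s) s :=
    fun s hs => hasDerivAt_of_eventually_eq_affine (h s hs)
  obtain ⟨s, hs, hs0⟩ := exists_hasDerivAt_eq_zero (hat.trans_le ht.2) hcont hends hderiv
  obtain ⟨u, hu, hslope⟩ := exists_hasDerivAt_eq_slope g σ hat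
    (hcont.mono (Icc_subset_Icc_right ht.2)) fun s hs => hderiv s ⟨hs.1, hs.2.trans_le ht.2⟩
  rw [slope_eq_of_locally_affine h ⟨hu.1, hu.2.trans_le ht.2⟩ hs, hs0, eq_comm,
    div_eq_zero_iff, sub_eq_zero, sub_eq_zero] at hslope
  exact hslope.resolve_right hat.ne'

theorem eq_of_hasRightSlope_add_reflect_eq_zero {L : ℝ} {τ : ℝ → ℝ} (hends : g 0 = g L)
    (hright : ∀ t ∈ Ico 0 L, HasRightSlope g (σ t) t)
    (hleft : ∀ t ∈ Ico 0 L, HasRightSlope (fun s => g (L - s)) (τ t) t)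
    (hkink : ∀ t ∈ Ioo 0 L, σ t + τ (L - t) = 0) (ht : t ∈ Icc 0 L) : g t = g 0 := by
  have hleft' : ∀ t ∈ Ioc 0 L, HasRightSlope (fun s => g (L - s)) (τ (L - t)) (L - t) :=
    fun t ht => hleft (L - t) ⟨sub_nonneg.2 ht.2, sub_lt_self L ht.1⟩
  have hloc : ∀ t ∈ Ioo 0 L, ∀ᶠ s in 𝓝 t, g s = g t + σ t * (s - t) := by
    intro t ht
    refine (hright t (Ioo_subset_Ico_self ht)).eventually_nhds (L := L) ?_
    rw [← eq_neg_of_add_eq_zero_right (hkink t ht)]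
    exact hleft' t (Ioo_subset_Ioc_self ht)
  refine eq_left_of_locally_affine (fun t ht => ?_) hends hloc ht
  rcases ht.1.eq_or_lt with rfl | h0
  · rcases ht.2.eq_or_lt with rfl | hL
    · simp
    · exact (hright 0 ⟨le_rfl, hL⟩).continuousWithinAt.mono fun s hs => hs.1
  · rcases ht.2.eq_or_lt with rfl | hL
    · exact (hleft' t ⟨h0, le_rfl⟩).continuousWithinAt_Iic.mono fun s hs => hs.2
    · exact (hasDerivAt_of_eventually_eq_affine (hloc t ⟨h0, hL⟩)).continuousAt.continuousWithinAt

end LocallyAffine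

/-- The voltage on a circle of circumference `L`, grounded at position `0`, when unit current enters
at position `b` and exits at position `a`. -/
noncomputable def circleVoltage (L a b u : ℝ) : ℝ :=
  max (u - a) 0 - max (u - b) 0 + (a - b) / L * u

/-- The right derivative of `circleVoltage L a b` at `u`. -/
noncomputable def circleVoltageSlope (L a b u : ℝ) : ℝ :=
  (if a ≤ u then 1 else 0) - (if b ≤ u then 1 else 0) + (a - b) / L

section CircleVoltage

variable {L a b : ℝ}

theorem hasRightSlope_circleVoltage (L a b t : ℝ) :
    HasRightSlope (circleVoltage L a b) (circleVoltageSlope L a b t) t :=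
  ((HasRightSlope.max_sub_zero a t).sub (.max_sub_zero b t)).add (.const_mul _ t)

theorem circleVoltage_zero (ha : 0 ≤ a) (hb : 0 ≤ b) : circleVoltage L a b 0 = 0 := by
  simp [circleVoltage, ha, hb]

theorem circleVoltage_reflect (hL : L ≠ 0) (a b u : ℝ) :
    circleVoltage L a b (L - u) = circleVoltage L (L - a) (L - b) u := by
  have hmax : ∀ c, max (L - u - c) 0 = max (u - (L - c)) 0 + (L - u - c) := by
    intro c
    rw [← max_add_add_right, zero_add, max_comm]
    congr 1
    ring
  simp only [circleVoltage, hmax]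
  field_simp
  ring

theorem circleVoltage_length (ha : a ∈ Icc 0 L) (hb : b ∈ Icc 0 L) : circleVoltage L a b L = 0 := by
  rcases (ha.1.trans ha.2).eq_or_lt with rfl | hL
  · exact circleVoltage_zero ha.1 hb.1
  · have h := circleVoltage_reflect hL.ne' a b 0
    rwa [sub_zero, circleVoltage_zero (sub_nonneg.2 ha.2) (sub_nonneg.2 hb.2)] at h

theorem circleVoltage_sub_eq_circleResistance (L a b : ℝ) :
    circleVoltage L a b b - circleVoltage L a b a = circleResistance L a b := by
  have habs : |a - b| = max (b - a) 0 + max (a - b) 0 := by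
    rw [← neg_sub a b, add_comm]
    exact (posPart_add_negPart (a - b)).symm
  simp only [circleVoltage, circleResistance, habs, sub_self, max_self]
  ring

theorem circleVoltageSlope_add_reflect (L a b t : ℝ) :
    circleVoltageSlope L a b t + circleVoltageSlope L (L - a) (L - b) (L - t) =
      (if a = t then 1 else 0) - (if b = t then 1 else 0) := by
  have hjump : ∀ c : ℝ, (if c ≤ t then (1 : ℝ) else 0) + (if L - c ≤ L - t then 1 else 0) =
      1 + if c = t then 1 else 0 := by
    intro c
    simp only [sub_le_sub_iff_left]
    rcases lt_trichotomy c t with h | rfl | h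
    · simp [h.le, h.not_ge, h.ne]
    · simp
    · simp [h.le, h.not_ge, h.ne']
  simp only [circleVoltageSlope]
  linear_combination hjump a - hjump b

theorem circleVoltageSlope_zero_add_reflect (ha : a ∈ Ico 0 L) (hb : b ∈ Ico 0 L) :
    circleVoltageSlope L a b 0 + circleVoltageSlope L (L - a) (L - b) 0 =
      (if a = 0 then 1 else 0) - (if b = 0 then 1 else 0) := by
  simp only [circleVoltageSlope, ha.1.ge_iff_eq', hb.1.ge_iff_eq', (sub_pos.2 ha.2).not_ge,
    (sub_pos.2 hb.2).not_ge, if_false]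
  ring

end CircleVoltage

/-! ### Voltages on a bouquet of circles -/

namespace LengthGraph

variable {V E : Type*}

theorem edgePath_of_mem (G : LengthGraph V E) {e : E} {t : ℝ} (ht : t ∈ Ioo 0 (G.length e)) :
    G.edgePath e t = Point.interior e t ht :=
  dif_pos ht

theorem edgePath_zero (G : LengthGraph V E) (e : E) :
    G.edgePath e 0 = Point.vertex (G.src e) := by
  simp [edgePath]

theorem edgePath_length (G : LengthGraph V E) (e : E) :
    G.edgePath e (G.length e) = Point.vertex (G.tgt e) := by
  simp [edgePath, G.length_pos e]

theorem path_zero (G : LengthGraph V E) (d : E × Bool) :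
    G.path d 0 = Point.vertex (if d.2 then G.src d.1 else G.tgt d.1) := by
  obtain ⟨e, _ | _⟩ := d
  · simpa [path] using G.edgePath_length e
  · simpa [path] using G.edgePath_zero e

theorem path_ne_vertex (G : LengthGraph V E) (d : E × Bool) {t : ℝ}
    (ht : t ∈ Ioo 0 (G.length d.1)) (v : V) : G.path d t ≠ Point.vertex v := by
  obtain ⟨e, _ | _⟩ := d
  · have ht' : G.length e - t ∈ Ioo 0 (G.length e) := ⟨sub_pos.2 ht.2, sub_lt_self _ ht.1⟩
    simp [path, edgePath_of_mem G ht']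
  · simp [path, edgePath_of_mem G ht]

theorem directions_vertex (G : LengthGraph V E) (v : V) :
    G.directions (Point.vertex v) =
      (fun d => (d, (0 : ℝ))) '' {d | G.path d 0 = Point.vertex v} := by
  ext ⟨d, t⟩
  simp only [directions, mem_ofPred_eq, mem_image, Prod.mk.injEq]
  constructor
  · rintro ⟨ht, hpath⟩
    obtain rfl | ht0 := ht.1.eq_or_lt
    · exact ⟨d, hpath, rfl, rfl⟩
    · exact absurd hpath (G.path_ne_vertex d ⟨ht0, ht.2⟩ v)
  · rintro ⟨d, hpath, rfl, rfl⟩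
    exact ⟨⟨le_rfl, G.length_pos d.1⟩, hpath⟩

theorem directions_vertex_of_subsingleton [Subsingleton V] (G : LengthGraph V E) (v : V) :
    G.directions (Point.vertex v) = range fun d : E × Bool => (d, (0 : ℝ)) := by
  have huniv : {d | G.path d 0 = Point.vertex v} = univ :=
    eq_univ_of_forall fun d => (G.path_zero d).trans (congrArg _ (Subsingleton.elim _ _))
  rw [directions_vertex, huniv, image_univ]

theorem directions_interior (G : LengthGraph V E) {e : E} {t : ℝ}
    (ht : t ∈ Ioo 0 (G.length e)) :
    G.directions (Point.interior e t ht) = {((e, true), t), ((e, false), G.length e - t)} := by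
  have hpath : ∀ e' u, G.edgePath e' u = Point.interior e t ht ↔ e' = e ∧ u = t := by
    refine fun e' u => ⟨fun h => ?_, ?_⟩
    · rw [edgePath] at h
      split_ifs at h
      exact Point.interior.inj h
    · rintro ⟨rfl, rfl⟩
      exact edgePath_of_mem G ht
  ext ⟨⟨e', _ | _⟩, u⟩ <;>
    simp only [directions, path, mem_ofPred_eq, hpath, mem_insert_iff, mem_singleton_iff,
      Prod.mk.injEq, Bool.false_eq_true, if_true, if_false] <;>
    grind

theorem finsum_directions_vertex [Subsingleton V] [Fintype E] (G : LengthGraph V E) (v : V)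
    (σ : E × Bool → ℝ → ℝ) :
    ∑ᶠ d ∈ G.directions (Point.vertex v), σ d.1 d.2 =
      ∑ e, (σ (e, true) 0 + σ (e, false) 0) := by
  rw [directions_vertex_of_subsingleton, finsum_mem_range fun _ _ h => (Prod.mk.inj h).1,
    finsum_eq_sum_of_fintype, Fintype.sum_prod_type]
  simp only [Fintype.sum_bool]

theorem finsum_directions_interior (G : LengthGraph V E) {e : E} {t : ℝ}
    (ht : t ∈ Ioo 0 (G.length e)) (σ : E × Bool → ℝ → ℝ) :
    ∑ᶠ d ∈ G.directions (Point.interior e t ht), σ d.1 d.2 =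
      σ (e, true) t + σ (e, false) (G.length e - t) := by
  rw [directions_interior, finsum_mem_pair (by simp)]

theorem valence_vertex [Subsingleton V] [Fintype E] (G : LengthGraph V E) (v : V) :
    G.valence (Point.vertex v) = 2 * Fintype.card E := by
  rw [valence, directions_vertex_of_subsingleton, ← image_univ,
    ncard_image_of_injective _ fun _ _ h => (Prod.mk.inj h).1, ncard_univ, Nat.card_eq_fintype_card,
    Fintype.card_prod, Fintype.card_bool, mul_comm]

theorem resistance_self (G : LengthGraph V E) (x : G.Point) : G.resistance x x = 0 := by
  have hconst : G.IsVoltage x x fun _ => 0 := ⟨fun _ _ => 0, by simp, by simp⟩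
  exact le_antisymm ((iInf₂_le _ hconst).trans (by simp)) zero_le

theorem deletedResistance_eq_zero (G : LengthGraph V E) {e : E} (he : G.src e = G.tgt e) :
    G.deletedResistance e = 0 := by
  rw [deletedResistance, he, resistance_self]

open Classical in
/-- The position of a point on the edge `e`, measured from `src e`. The points outside the interior
of `e`, including `tgt e`, get the position `0`: for a self-loop this is the projection of the graph
onto the circle `e`. -/
noncomputable def coord (G : LengthGraph V E) (e : E) : G.Point → ℝ
  | Point.vertex _ => 0
  | Point.interior e' t _ => if e' = e then t else 0

theorem coord_vertex (G : LengthGraph V E) (e : E) (v : V) : G.coord e (Point.vertex v) = 0 :=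
  rfl

theorem coord_interior_self (G : LengthGraph V E) {e : E} {t : ℝ}
    (ht : t ∈ Ioo 0 (G.length e)) : G.coord e (Point.interior e t ht) = t :=
  if_pos rfl

theorem coord_interior_of_ne (G : LengthGraph V E) {e e' : E} (h : e' ≠ e) {t : ℝ}
    (ht : t ∈ Ioo 0 (G.length e')) : G.coord e (Point.interior e' t ht) = 0 :=
  if_neg h

theorem coord_mem_Ico (G : LengthGraph V E) (e : E) (x : G.Point) :
    G.coord e x ∈ Ico 0 (G.length e) := by
  have hzero : (0 : ℝ) ∈ Ico 0 (G.length e) := ⟨le_rfl, G.length_pos e⟩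
  rcases x with _ | ⟨e', t, ht⟩
  · exact hzero
  · rw [coord]
    split_ifs with h
    · exact h ▸ Ioo_subset_Ico_self ht
    · exact hzero

theorem coord_mem_Icc (G : LengthGraph V E) (e : E) (x : G.Point) :
    G.coord e x ∈ Icc 0 (G.length e) :=
  Ico_subset_Icc_self (G.coord_mem_Ico e x)

theorem coord_eq_iff (G : LengthGraph V E) {e : E} {t : ℝ} (ht : t ∈ Ioo 0 (G.length e))
    (x : G.Point) : G.coord e x = t ↔ Point.interior e t ht = x := by
  refine ⟨fun h => ?_, fun h => h ▸ coord_interior_self G ht⟩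
  rcases x with v | ⟨e', u, hu⟩
  · exact absurd h ht.1.ne
  · obtain rfl | he := eq_or_ne e' e
    · rw [coord_interior_self] at h
      subst h
      rfl
    · rw [coord_interior_of_ne G he] at h
      exact absurd h ht.1.ne

theorem coord_edgePath_self (G : LengthGraph V E) (e : E) (t : ℝ) :
    G.coord e (G.edgePath e t) = (Ioo 0 (G.length e)).indicator id t := by
  by_cases ht : t ∈ Ioo 0 (G.length e)
  · rw [edgePath_of_mem G ht, coord_interior_self, indicator_of_mem ht, id]
  · rw [edgePath, dif_neg ht, indicator_of_notMem ht]
    split_ifs <;> rfl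

theorem coord_edgePath_of_ne (G : LengthGraph V E) {e e' : E} (h : e' ≠ e) (t : ℝ) :
    G.coord e (G.edgePath e' t) = 0 := by
  rw [edgePath]
  split_ifs
  · exact coord_interior_of_ne G h _
  · rfl
  · rfl

open Classical in
theorem sum_ite_coord_eq_zero [Subsingleton V] [Fintype E] (G : LengthGraph V E) (v : V)
    (x : G.Point) :
    ∑ e, (if G.coord e x = 0 then (1 : ℝ) else 0) =
      Fintype.card E - 1 + if Point.vertex v = x then 1 else 0 := by
  rcases x with w | ⟨e', t, ht⟩
  · simp [coord_vertex, Subsingleton.elim w v]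
  · have hcoord : ∀ e, (if G.coord e (Point.interior e' t ht) = 0 then (1 : ℝ) else 0) =
        1 - if e = e' then 1 else 0 := by
      intro e
      obtain rfl | he := eq_or_ne e e'
      · simp [coord_interior_self, ht.1.ne']
      · simp [coord_interior_of_ne G he.symm, he]
    simp [hcoord]

/-- On a graph with one vertex, the voltage grounded at the vertex when unit current enters at `y`
and exits at `x`. -/
noncomputable def bouquetVoltage [Fintype E] (G : LengthGraph V E) (x y z : G.Point) : ℝ :=
  ∑ e, circleVoltage (G.length e) (G.coord e x) (G.coord e y) (G.coord e z)

/-- The slope of `bouquetVoltage` in the direction `d` at distance `t` from the start of `d`. -/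
noncomputable def bouquetVoltageSlope (G : LengthGraph V E) (x y : G.Point) (d : E × Bool) (t : ℝ) :
    ℝ :=
  if d.2 then circleVoltageSlope (G.length d.1) (G.coord d.1 x) (G.coord d.1 y) t
  else circleVoltageSlope (G.length d.1) (G.length d.1 - G.coord d.1 x)
    (G.length d.1 - G.coord d.1 y) t

theorem bouquetVoltage_edgePath [Fintype E] (G : LengthGraph V E) (x y : G.Point) (e : E) {t : ℝ}
    (ht : t ∈ Icc 0 (G.length e)) :
    G.bouquetVoltage x y (G.edgePath e t) =
      circleVoltage (G.length e) (G.coord e x) (G.coord e y) t := by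
  have hzero : ∀ e, circleVoltage (G.length e) (G.coord e x) (G.coord e y) 0 = 0 :=
    fun e => circleVoltage_zero (G.coord_mem_Icc e x).1 (G.coord_mem_Icc e y).1
  rw [bouquetVoltage, Finset.sum_eq_single e _ (by simp), coord_edgePath_self]
  · by_cases ht' : t ∈ Ioo 0 (G.length e)
    · rw [indicator_of_mem ht', id]
    · rw [indicator_of_notMem ht', hzero]
      rcases eq_endpoints_or_mem_Ioo_of_mem_Icc ht with rfl | rfl | h
      · exact (hzero e).symm
      · exact (circleVoltage_length (G.coord_mem_Icc e x) (G.coord_mem_Icc e y)).symm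
      · exact absurd h ht'
  · intro e' _ he'
    rw [coord_edgePath_of_ne G he'.symm, hzero]

theorem hasRightSlope_bouquetVoltage_path [Fintype E] (G : LengthGraph V E) (x y : G.Point)
    (d : E × Bool) {t : ℝ} (ht : t ∈ Ico 0 (G.length d.1)) :
    HasRightSlope (fun s => G.bouquetVoltage x y (G.path d s))
      (G.bouquetVoltageSlope x y d t) t := by
  obtain ⟨e, _ | _⟩ := d <;>
    refine (hasRightSlope_circleVoltage _ _ _ t).congr_of_eqOn_Ico ht.2 fun s hs => ?_
  · have hs' : G.length e - s ∈ Icc 0 (G.length e) :=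
      ⟨sub_nonneg.2 hs.2.le, sub_le_self _ (ht.1.trans hs.1)⟩
    exact (G.bouquetVoltage_edgePath x y e hs').trans
      (circleVoltage_reflect (G.length_pos e).ne' _ _ s)
  · exact G.bouquetVoltage_edgePath x y e ⟨ht.1.trans hs.1, hs.2.le⟩

open Classical in
theorem finsum_bouquetVoltageSlope [Subsingleton V] [Finite E] (G : LengthGraph V E)
    (x y z : G.Point) :
    ∑ᶠ d ∈ G.directions z, G.bouquetVoltageSlope x y d.1 d.2 =
      (if z = x then 1 else 0) - (if z = y then 1 else 0) := by
  cases nonempty_fintype E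
  rcases z with v | ⟨e, t, ht⟩
  · have hslope : ∀ e, G.bouquetVoltageSlope x y (e, true) 0 +
        G.bouquetVoltageSlope x y (e, false) 0 =
          (if G.coord e x = 0 then 1 else 0) - (if G.coord e y = 0 then 1 else 0) :=
      fun e => circleVoltageSlope_zero_add_reflect (G.coord_mem_Ico e x) (G.coord_mem_Ico e y)
    simp only [finsum_directions_vertex, hslope, Finset.sum_sub_distrib, sum_ite_coord_eq_zero G v]
    ring
  · rw [finsum_directions_interior]
    simp only [← coord_eq_iff G ht]
    exact circleVoltageSlope_add_reflect _ _ _ _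

theorem isVoltage_bouquetVoltage [Subsingleton V] [Fintype E] (G : LengthGraph V E)
    (x y : G.Point) : G.IsVoltage x y (G.bouquetVoltage x y) := by
  refine ⟨G.bouquetVoltageSlope x y,
    fun d t ht => G.hasRightSlope_bouquetVoltage_path x y d ht, fun z => ?_⟩
  rw [finsum_bouquetVoltageSlope, neg_sub]

theorem IsVoltage.sub_interior_eq_sub_vertex {G : LengthGraph V E} {x y : G.Point}
    {f g : G.Point → ℝ} (hf : G.IsVoltage x y f) (hg : G.IsVoltage x y g) {e : E}
    (he : G.src e = G.tgt e) {t : ℝ} (ht : t ∈ Ioo 0 (G.length e)) :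
    f (Point.interior e t ht) - g (Point.interior e t ht) =
      f (Point.vertex (G.src e)) - g (Point.vertex (G.src e)) := by
  obtain ⟨σ, hσ, hσ_kirchhoff⟩ := hf
  obtain ⟨τ, hτ, hτ_kirchhoff⟩ := hg
  have hkink : ∀ s ∈ Ioo 0 (G.length e), (σ (e, true) s - τ (e, true) s) +
      (σ (e, false) (G.length e - s) - τ (e, false) (G.length e - s)) = 0 := by
    intro s hs
    have hστ := (hσ_kirchhoff (Point.interior e s hs)).trans
      (hτ_kirchhoff (Point.interior e s hs)).symm
    rw [finsum_directions_interior, finsum_directions_interior] at hστ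
    linarith
  have hends : f (G.edgePath e 0) - g (G.edgePath e 0) =
      f (G.edgePath e (G.length e)) - g (G.edgePath e (G.length e)) := by
    rw [edgePath_zero, edgePath_length, he]
  have hconst := eq_of_hasRightSlope_add_reflect_eq_zero
    (g := fun s => f (G.edgePath e s) - g (G.edgePath e s)) hends
    (fun s hs => HasRightSlope.sub (hσ (e, true) s hs) (hτ (e, true) s hs))
    (fun s hs => HasRightSlope.sub (hσ (e, false) s hs) (hτ (e, false) s hs))
    hkink (Ioo_subset_Icc_self ht)
  simpa only [edgePath_of_mem G ht, edgePath_zero] using hconst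

theorem IsVoltage.sub_eq_sub [Subsingleton V] {G : LengthGraph V E} {x y : G.Point}
    {f g : G.Point → ℝ} (hf : G.IsVoltage x y f) (hg : G.IsVoltage x y g) (z w : G.Point) :
    f z - f w = g z - g w := by
  have hvertex : ∀ z, ∃ v, f z - g z = f (Point.vertex v) - g (Point.vertex v) := by
    rintro (v | ⟨e, t, ht⟩)
    · exact ⟨v, rfl⟩
    · exact ⟨G.src e, hf.sub_interior_eq_sub_vertex hg (Subsingleton.elim _ _) ht⟩
  obtain ⟨v, hz⟩ := hvertex z
  obtain ⟨u, hw⟩ := hvertex w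
  rw [Subsingleton.elim u v] at hw
  linarith

theorem resistance_eq_sum_circleResistance [Subsingleton V] [Fintype E] (G : LengthGraph V E)
    (x y : G.Point) :
    G.resistance x y =
      ENNReal.ofReal (∑ e, circleResistance (G.length e) (G.coord e x) (G.coord e y)) := by
  have hdrop : G.bouquetVoltage x y y - G.bouquetVoltage x y x =
      ∑ e, circleResistance (G.length e) (G.coord e x) (G.coord e y) := by
    simp only [bouquetVoltage, ← Finset.sum_sub_distrib, circleVoltage_sub_eq_circleResistance]
  have hvoltage := G.isVoltage_bouquetVoltage x y
  rw [← hdrop]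
  refine le_antisymm (iInf₂_le _ hvoltage) (le_iInf₂ fun f hf => ?_)
  rw [hf.sub_eq_sub hvoltage]

/-! ### Measures on a bouquet of circles -/

theorem lowerSemicontinuous_coord (G : LengthGraph V E) (e : E) :
    LowerSemicontinuous (G.coord e) := by
  refine lowerSemicontinuous_iff_isOpen_preimage.2 fun c => isOpen_iSup_iff.2 fun e' => ?_
  rw [isOpen_coinduced]
  change IsOpen ((fun t => G.coord e (G.edgePath e' t)) ⁻¹' Ioi c)
  obtain rfl | he := eq_or_ne e' e
  · simp only [coord_edgePath_self]
    obtain hc | hc := lt_or_ge c 0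
    · have huniv : (Ioo 0 (G.length e')).indicator id ⁻¹' Ioi c = univ :=
        eq_univ_of_forall fun t => hc.trans_le (indicator_nonneg (fun _ ht => ht.1.le) t)
      exact huniv ▸ isOpen_univ
    · have hIoo : (Ioo 0 (G.length e')).indicator id ⁻¹' Ioi c = Ioo 0 (G.length e') ∩ Ioi c := by
        ext t
        by_cases ht : t ∈ Ioo 0 (G.length e') <;> simp [ht, hc.not_gt]
      exact hIoo ▸ isOpen_Ioo.inter isOpen_Ioi
  · simp only [coord_edgePath_of_ne G he]
    exact isOpen_const

theorem measurable_coord (G : LengthGraph V E) (e : E) : Measurable (G.coord e) :=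
  (G.lowerSemicontinuous_coord e).measurable

theorem inv_ofReal_length_mul_self (G : LengthGraph V E) (e : E) :
    (ENNReal.ofReal (G.length e))⁻¹ * ENNReal.ofReal (G.length e) = 1 :=
  ENNReal.inv_mul_cancel (ENNReal.ofReal_pos.2 (G.length_pos e)).ne' ENNReal.ofReal_ne_top

theorem edgeMeasure_univ (G : LengthGraph V E) (e : E) :
    G.edgeMeasure e univ = ENNReal.ofReal (G.length e) := by
  rw [edgeMeasure, Measure.map_apply (G.continuous_edgePath e).measurable MeasurableSet.univ]
  simp

theorem map_coord_edgeMeasure_self (G : LengthGraph V E) (e : E) :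
    (G.edgeMeasure e).map (G.coord e) = volume.restrict (Icc 0 (G.length e)) := by
  have hcoord : G.coord e ∘ G.edgePath e =ᵐ[volume.restrict (Icc 0 (G.length e))] id := by
    rw [← restrict_Ioo_eq_restrict_Icc]
    filter_upwards [ae_restrict_mem measurableSet_Ioo] with t ht
    rw [Function.comp_apply, coord_edgePath_self, indicator_of_mem ht]
  rw [edgeMeasure, Measure.map_map (G.measurable_coord e) (G.continuous_edgePath e).measurable,
    Measure.map_congr hcoord, Measure.map_id]

theorem map_coord_edgeMeasure_of_ne (G : LengthGraph V E) {e e' : E} (h : e' ≠ e) :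
    (G.edgeMeasure e').map (G.coord e) = ENNReal.ofReal (G.length e') • Measure.dirac 0 := by
  have hcoord : G.coord e ∘ G.edgePath e' = fun _ => 0 :=
    funext fun t => G.coord_edgePath_of_ne h t
  rw [edgeMeasure, Measure.map_map (G.measurable_coord e) (G.continuous_edgePath e').measurable,
    hcoord, Measure.map_const]
  simp

theorem integrable_comp_coord (G : LengthGraph V E) (e : E) (μ : Measure G.Point)
    [IsFiniteMeasure μ] {F : ℝ → ℝ} (hF : Continuous F) :
    Integrable (fun x => F (G.coord e x)) μ := by
  obtain ⟨C, hC⟩ := isCompact_Icc.exists_bound_of_continuousOn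
    (s := Icc 0 (G.length e)) hF.continuousOn
  exact Integrable.of_bound (hF.measurable.comp (G.measurable_coord e)).aestronglyMeasurable C
    (Eventually.of_forall fun x => hC _ (G.coord_mem_Icc e x))

end LengthGraph

namespace PMGraph

open LengthGraph (Point)

variable {V E : Type*} [Fintype V] [Fintype E]

theorem r_self (G : PMGraph V E) (x : G.Point) : G.r x x = 0 := by
  rw [r, LengthGraph.resistance_self, ENNReal.toReal_zero]

theorem r_nonneg (G : PMGraph V E) (x y : G.Point) : 0 ≤ G.r x y :=
  ENNReal.toReal_nonneg

variable [Unique V]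

theorem genus_eq (G : PMGraph V E) : (G.genus : ℝ) = Fintype.card E + G.q default := by
  rw [genus, LengthGraph.bettiNumber, Fintype.card_unique (α := V), Fintype.sum_unique]
  push_cast
  ring

theorem canonicalDivisor_eq (G : PMGraph V E) :
    (G.canonicalDivisor default : ℝ) = 2 * (G.genus - 1) := by
  rw [canonicalDivisor, LengthGraph.valence_vertex, genus_eq]
  push_cast
  ring

theorem one_le_genus (G : PMGraph V E) : 1 ≤ (G.genus : ℝ) := by
  have heffective : (0 : ℝ) ≤ G.canonicalDivisor default := by
    exact_mod_cast G.effective default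
  rw [canonicalDivisor_eq] at heffective
  linarith

theorem genus_pos (G : PMGraph V E) : 0 < (G.genus : ℝ) :=
  one_pos.trans_le G.one_le_genus

theorem canonicalDivisorMeasure_eq (G : PMGraph V E) :
    G.canonicalDivisorMeasure =
      ENNReal.ofReal (2 * (G.genus - 1)) • Measure.dirac (Point.vertex default) := by
  have htoNat : ((G.canonicalDivisor default).toNat : ℝ) = 2 * (G.genus - 1) := by
    rw [← canonicalDivisor_eq]
    exact_mod_cast Int.toNat_of_nonneg (G.effective default)
  rw [canonicalDivisorMeasure, Fintype.sum_unique, ← htoNat, ENNReal.ofReal_natCast,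
    Nat.cast_smul_eq_nsmul]

theorem admissibleMeasure_eq (G : PMGraph V E) :
    G.admissibleMeasure = ENNReal.ofReal (1 / G.genus) •
      (G.q default • Measure.dirac (Point.vertex default) +
        ∑ e, (ENNReal.ofReal (G.length e))⁻¹ • G.edgeMeasure e) := by
  simp only [admissibleMeasure, Fintype.sum_unique,
    G.deletedResistance_eq_zero (Subsingleton.elim _ _), add_zero]

instance (G : PMGraph V E) : IsProbabilityMeasure G.admissibleMeasure := by
  have hgenus : (G.q default : ENNReal) + Fintype.card E = ENNReal.ofReal G.genus := by
    rw [genus_eq, ← Nat.cast_add, ← Nat.cast_add, ENNReal.ofReal_natCast, add_comm]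
  refine ⟨?_⟩
  simp only [admissibleMeasure_eq, Measure.smul_apply, Measure.add_apply, Measure.finsetSum_apply,
    LengthGraph.edgeMeasure_univ, measure_univ, smul_eq_mul, nsmul_eq_mul,
    LengthGraph.inv_ofReal_length_mul_self, mul_one, Finset.sum_const, Finset.card_univ, hgenus]
  rw [← ENNReal.ofReal_mul (one_div_nonneg.2 G.genus_pos.le), one_div_mul_cancel G.genus_pos.ne',
    ENNReal.ofReal_one]

theorem map_coord_admissibleMeasure (G : PMGraph V E) (e : E) :
    G.admissibleMeasure.map (G.coord e) = ENNReal.ofReal (1 / G.genus) •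
      (ENNReal.ofReal (G.genus - 1) • Measure.dirac 0 +
        (ENNReal.ofReal (G.length e))⁻¹ • volume.restrict (Icc 0 (G.length e))) := by
  classical
  have hcoord := G.measurable_coord e
  have hother : ∀ e' ∈ Finset.univ.erase e,
      ((ENNReal.ofReal (G.length e'))⁻¹ • G.edgeMeasure e').map (G.coord e) =
        Measure.dirac 0 := by
    intro e' he'
    rw [Measure.map_smul, G.map_coord_edgeMeasure_of_ne (Finset.ne_of_mem_erase he'), smul_smul,
      G.inv_ofReal_length_mul_self, one_smul]
  have hgenus : (G.genus : ℝ) - 1 = (G.q default + (Finset.univ.erase e).card : ℕ) := by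
    rw [genus_eq, Finset.card_erase_of_mem (Finset.mem_univ e), Finset.card_univ, Nat.cast_add,
      Nat.cast_pred (Fintype.card_pos_iff.2 ⟨e⟩)]
    ring
  rw [admissibleMeasure_eq, Measure.map_smul, Measure.map_add _ _ hcoord, Measure.map_smul,
    Measure.map_dirac' hcoord, Measure.map_finset_sum' hcoord.aemeasurable,
    ← Finset.sum_erase_add _ _ (Finset.mem_univ e), Finset.sum_congr rfl hother, Finset.sum_const,
    Measure.map_smul, G.map_coord_edgeMeasure_self, hgenus, ENNReal.ofReal_natCast, ← add_assoc,
    G.coord_vertex, Nat.cast_smul_eq_nsmul, add_smul]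

theorem integral_comp_coord_admissibleMeasure (G : PMGraph V E) (e : E) {F : ℝ → ℝ}
    (hF : Continuous F) :
    ∫ x, F (G.coord e x) ∂G.admissibleMeasure =
      ((G.genus - 1) * F 0 + (∫ t in (0 : ℝ)..G.length e, F t) / G.length e) / G.genus := by
  have hL := G.length_pos e
  have hdirac : Integrable F (ENNReal.ofReal (G.genus - 1) • Measure.dirac 0) :=
    (integrable_dirac (by simp)).smul_measure ENNReal.ofReal_ne_top
  have hvolume : Integrable F
      ((ENNReal.ofReal (G.length e))⁻¹ • volume.restrict (Icc 0 (G.length e))) :=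
    hF.integrableOn_Icc.smul_measure (by simpa using hL)
  rw [← integral_map (G.measurable_coord e).aemeasurable hF.aestronglyMeasurable,
    map_coord_admissibleMeasure, integral_smul_measure, integral_add_measure hdirac hvolume,
    integral_smul_measure, integral_smul_measure, integral_dirac, integral_Icc_eq_integral_Ioc,
    ← intervalIntegral.integral_of_le hL.le, ENNReal.toReal_inv, ENNReal.toReal_ofReal hL.le,
    ENNReal.toReal_ofReal (sub_nonneg.2 G.one_le_genus),
    ENNReal.toReal_ofReal (one_div_nonneg.2 G.genus_pos.le), smul_eq_mul, smul_eq_mul, smul_eq_mul,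
    one_div_mul_eq_div, inv_mul_eq_div]

theorem r_eq_sum_circleResistance (G : PMGraph V E) (x y : G.Point) :
    G.r x y = ∑ e, circleResistance (G.length e) (G.coord e x) (G.coord e y) := by
  rw [r, LengthGraph.resistance_eq_sum_circleResistance, ENNReal.toReal_ofReal]
  exact Finset.sum_nonneg fun e _ =>
    circleResistance_nonneg (G.length_pos e) (G.coord_mem_Icc e x) (G.coord_mem_Icc e y)

theorem r_comm (G : PMGraph V E) (x y : G.Point) : G.r x y = G.r y x := by
  simp only [r_eq_sum_circleResistance, circleResistance_comm]

theorem r_le_totalLength (G : PMGraph V E) (x y : G.Point) : G.r x y ≤ G.totalLength := by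
  rw [r_eq_sum_circleResistance]
  exact Finset.sum_le_sum fun e _ => circleResistance_le (G.coord_mem_Icc e x) (G.coord_mem_Icc e y)

theorem measurable_r (G : PMGraph V E) : Measurable fun z : G.Point × G.Point => G.r z.1 z.2 := by
  simp only [r_eq_sum_circleResistance]
  exact Finset.measurable_sum _ fun e _ =>
    (continuous_circleResistance (G.length e)).measurable.comp
      (((G.measurable_coord e).comp measurable_fst).prodMk
        ((G.measurable_coord e).comp measurable_snd))

theorem integrable_r {Ω : Type*} [MeasurableSpace Ω] (G : PMGraph V E) {x y : Ω → G.Point}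
    (hx : Measurable x) (hy : Measurable y) (μ : Measure Ω) [IsFiniteMeasure μ] :
    Integrable (fun ω => G.r (x ω) (y ω)) μ :=
  Integrable.of_bound (G.measurable_r.comp (hx.prodMk hy)).aestronglyMeasurable G.totalLength
    (Eventually.of_forall fun _ =>
      (Real.norm_of_nonneg (G.r_nonneg _ _)).trans_le (G.r_le_totalLength _ _))

theorem integral_r_admissibleMeasure (G : PMGraph V E) (x : G.Point) :
    ∫ y, G.r x y ∂G.admissibleMeasure =
      ((G.genus - 1) * G.r x (Point.vertex default) + G.totalLength / 6) / G.genus := by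
  have hcont : ∀ e, Continuous (circleResistance (G.length e) (G.coord e x)) := fun e =>
    (continuous_circleResistance (G.length e)).comp (Continuous.prodMk_right _)
  have hcircle : ∀ e, (∫ t in (0 : ℝ)..G.length e,
      circleResistance (G.length e) (G.coord e x) t) / G.length e = G.length e / 6 := by
    intro e
    rw [integral_circleResistance (G.coord_mem_Icc e x), div_right_comm, sq,
      mul_div_cancel_right₀ _ (G.length_pos e).ne']
  simp only [r_eq_sum_circleResistance]
  rw [integral_finsetSum _ fun e _ => G.integrable_comp_coord e _ (hcont e)]
  simp only [G.integral_comp_coord_admissibleMeasure _ (hcont _), hcircle, G.coord_vertex,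
    LengthGraph.totalLength, Finset.mul_sum, Finset.sum_div, ← Finset.sum_add_distrib]

theorem integral_r_vertex_admissibleMeasure (G : PMGraph V E) :
    ∫ y, G.r (Point.vertex default) y ∂G.admissibleMeasure = G.totalLength / 6 / G.genus := by
  rw [integral_r_admissibleMeasure, r_self, mul_zero, zero_add]

theorem epsilonInv_eq (G : PMGraph V E) :
    G.epsilonInv = ((G.genus : ℝ) - 1) / (3 * G.genus) * G.totalLength := by
  have := Measure.smul_finite (Measure.dirac (Point.vertex default : G.Point))
    (ENNReal.ofReal_ne_top (r := 2 * (G.genus - 1)))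
  have hpotential : StronglyMeasurable fun x => ∫ y, G.r x y ∂G.admissibleMeasure :=
    G.measurable_r.stronglyMeasurable.integral_prod_right
  have hcoeff : (0 : ℝ) ≤ 2 * (G.genus - 1) :=
    mul_nonneg two_pos.le (sub_nonneg.2 G.one_le_genus)
  rw [epsilonInv, canonicalDivisorMeasure_eq,
    integral_prod _ (G.integrable_r measurable_fst measurable_snd _), integral_smul_measure,
    integral_dirac' _ _ hpotential, integral_r_vertex_admissibleMeasure,
    ENNReal.toReal_ofReal hcoeff, smul_eq_mul]
  field_simp
  ring

theorem zInv_eq (G : PMGraph V E) :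
    G.zInv = (2 * (G.genus : ℝ) - 1) / (12 * (G.genus : ℝ) ^ 2) * G.totalLength := by
  have hint : Integrable (fun x => G.r x (Point.vertex default)) G.admissibleMeasure :=
    G.integrable_r measurable_id measurable_const _
  have hvertex : ∫ x, G.r x (Point.vertex default) ∂G.admissibleMeasure =
      G.totalLength / 6 / G.genus := by
    simp only [G.r_comm _ (Point.vertex default), integral_r_vertex_admissibleMeasure]
  have hg := G.genus_pos
  rw [zInv, integral_prod _ (G.integrable_r measurable_fst measurable_snd _)]
  simp only [integral_r_admissibleMeasure]
  rw [integral_div, integral_add (hint.const_mul _) (integrable_const _), integral_const_mul,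
    hvertex, integral_const, probReal_univ, one_smul]
  field_simp
  ring

theorem phiInv_eq (G : PMGraph V E) :
    G.phiInv = ((G.genus : ℝ) - 1) / (6 * G.genus) * G.totalLength := by
  have hg := G.genus_pos
  rw [phiInv, zInv_eq, epsilonInv_eq]
  field_simp
  ring

theorem lambdaInv_eq (G : PMGraph V E) :
    G.lambdaInv = (G.genus : ℝ) / (8 * G.genus + 4) * G.totalLength := by
  have hg := G.genus_pos
  rw [lambdaInv, phiInv_eq, epsilonInv_eq]
  field_simp
  ring

end PMGraph

theorem mainTheorem3 {V E : Type*} [Fintype V] [Fintype E] (G : PMGraph V E)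
    (hV : Fintype.card V = 1) (hE : 1 ≤ Fintype.card E) :
    G.phiInv = ((G.genus : ℝ) - 1) / (6 * (G.genus : ℝ)) * G.totalLength ∧
    G.zInv = (2 * (G.genus : ℝ) - 1) / (12 * (G.genus : ℝ) ^ 2) * G.totalLength ∧
    G.lambdaInv = (G.genus : ℝ) / (8 * (G.genus : ℝ) + 4) * G.totalLength ∧
    G.epsilonInv = ((G.genus : ℝ) - 1) / (3 * (G.genus : ℝ)) * G.totalLength := by
  obtain ⟨_⟩ := Fintype.card_eq_one_iff_nonempty_unique.1 hV
  exact ⟨G.phiInv_eq, G.zInv_eq, G.lambdaInv_eq, G.epsilonInv_eq⟩
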